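/- Let $T>0$ and $\lambda>0$. The solution of the heat equation $u_t=\tfrac12u_{xx}$, $x\in\mathbb R$, with Dirac initial data $u(\cdot,0)=\delta$ is $u(x,t)=(2\pi t)^{-1/2}e^{-x^2/(2t)}$. In the time variable $\tilde t=\sqrt t$ the equation becomes $u_{\tilde t}=\tilde t\,u_{xx}$. For an integer $N\ge1$ put $k=\sqrt T/N$, $h=k/\lambda$, $\tilde t^{\,n}=nk$, $x_j=jh$ ($0\le n\le N$, $j\in\mathbb Z$), and consider the Crank–Nicolson central difference scheme $$\frac{U^{n+1}_j-U^n_j}{k}=\frac12\,\tilde t^{\,n}\,\frac{U^n_{j+1}-2U^n_j+U^n_{j-1}}{h^2}+\frac12\,\tilde t^{\,n+1}\,\frac{U^{n+1}_{j+1}-2U^{n+1}_j+U^{n+1}_{j-1}}{h^2},\qquad 0\le n<N,$$ with discrete Dirac initial data $U^0_0=1/h$, $U^0_j=0$ for $j\ne0$. It has exactly one solution for which every $U^n=(U^n_j)_{j\in\mathbb Z}$ is bounded. Let $E_N=\sup_{j\in\mathbb Z}|U^N_j-u(x_j,T)|$ be its error in the maximum norm at the final time $t=T$. Let $N\to\infty$,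 that is, $k\to0$ with $\lambda=k/h$ held fixed. Then $E_N\to0$ for every $\lambda>0$, and, with constants that depend only on $\lambda$ and $T$: 1. if $\lambda\le1/\sqrt2$, then $E_N=O(h^2)$; 2. if $\lambda\ge1/\sqrt2$, then $E_N=O(h^{1/\lambda^2})$; 3. if $\lambda>1/\sqrt2$, then more precisely $E_N=O\big(h^{1/\lambda^2}/\sqrt{\log(1/h)}\big)$. -/

import Mathlib

open Filter Topology
open scoped ENNReal

noncomputable section

namespace TimeChangedCN

/-- The function `v` (first argument time, second argument space) is a classical solution of
`v_τ = c(τ) v_xx` for `τ > 0`, `x ∈ ℝ`, with the Dirac measure at `0` as initial datum. The initial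
datum is attained in the weak sense, against every bounded continuous function. -/
structure SolvesWithDiracData (c : ℝ → ℝ) (v : ℝ → ℝ → ℝ) : Prop where
  smooth_space : ∀ τ : ℝ, 0 < τ → ContDiff ℝ 2 (v τ)
  equation : ∀ τ : ℝ, 0 < τ → ∀ x : ℝ,
    HasDerivAt (fun σ => v σ x) (c τ * iteratedDeriv 2 (v τ) x) τ
  integrable : ∀ τ : ℝ, 0 < τ → MeasureTheory.Integrable (v τ)
  initial : ∀ φ : ℝ → ℝ, Continuous φ → (∃ B : ℝ, ∀ x, |φ x| ≤ B) →
    Tendsto (fun τ => ∫ x, v τ x * φ x) (𝓝[>] 0) (𝓝 (φ 0))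

/-- The solution `u` of `u_t = (1/2) u_xx` with Dirac initial data. -/
def heatSolution (t x : ℝ) : ℝ :=
  1 / Real.sqrt (2 * Real.pi * t) * Real.exp (-x ^ 2 / (2 * t))

/-- The same solution in the time variable `τ = √t`, that is, at time `t = τ ^ 2`. -/
def timeChangedSolution (τ x : ℝ) : ℝ := heatSolution (τ ^ 2) x

/-- The time step when `[0, √T]` is divided into `N` equal steps. -/
def timeStep (T : ℝ) (N : ℕ) : ℝ := Real.sqrt T / N

/-- The space step `h`, determined by `k / h = lam` for the time step `k`. -/
def spaceStep (T lam : ℝ) (N : ℕ) : ℝ := timeStep T N / lam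

/-- The second central difference of the grid function `V` with space step `h`. -/
def centralDiff (h : ℝ) (V : ℤ → ℝ) (j : ℤ) : ℝ :=
  (V (j + 1) - 2 * V j + V (j - 1)) / h ^ 2

/-- `U n j` (for `n ≤ N`, `j ∈ ℤ`) is the numerical solution, at the grid point `x_j = j h` and the
time level `τ_n = n k`, of the Crank-Nicolson central difference scheme for `v_τ = τ v_xx` with
discrete Dirac initial data. The linear system of each implicit step is solved among the bounded
grid functions. -/
structure IsCrankNicolson (k h : ℝ) (N : ℕ) (U : ℕ → ℤ → ℝ) : Prop where
  initial : ∀ j : ℤ, U 0 j = if j = 0 then 1 / h else 0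
  bounded : ∀ n : ℕ, n ≤ N → ∃ B : ℝ, ∀ j : ℤ, |U n j| ≤ B
  step : ∀ n : ℕ, n < N → ∀ j : ℤ,
    (U (n + 1) j - U n j) / k =
      1 / 2 * ((n : ℝ) * k) * centralDiff h (U n) j
        + 1 / 2 * (((n + 1 : ℕ) : ℝ) * k) * centralDiff h (U (n + 1)) j

/-- The error in the maximum norm, over all grid points `x_j = j h`, of the grid function `V` at the
final time `τ = √T`. -/
def maxError (T h : ℝ) (V : ℤ → ℝ) : ℝ≥0∞ :=
  ⨆ j : ℤ, ENNReal.ofReal |V j - timeChangedSolution (Real.sqrt T) ((j : ℝ) * h)|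

/-- As the number `N` of time steps tends to infinity with `k / h = lam` fixed, the error of the
scheme in the maximum norm at the final time is `O (rate h)`. -/
def ErrorIsBigO (T lam : ℝ) (rate : ℝ → ℝ) : Prop :=
  ∃ C : ℝ, 0 < C ∧ ∀ᶠ N : ℕ in atTop, ∀ U : ℕ → ℤ → ℝ,
    IsCrankNicolson (timeStep T N) (spaceStep T lam N) N U →
      maxError T (spaceStep T lam N) (U N) ≤ ENNReal.ofReal (C * rate (spaceStep T lam N))

end TimeChangedCN

end

/-!
A Fourier mode `e^{ijθ}` is an eigenvector of the central difference, so `N` steps of the scheme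
multiply it by `P_N = ∏_{m<N} (1 - a m) / (1 + a (m + 1))` with `a = λ² (1 - cos θ)`, while the heat
flow multiplies it by `G = e^{-λ²N²θ²/2}`. Both the numerical and the exact solution at the final
time are cosine integrals of these factors (`isCrankNicolson_fourierSolution`,
`heatSolution_eq_integral`), so the maximum error is at most a multiple of `N` times the `L¹`
distance of `P_N` and `G` (`abs_error_le_integral`). The scheme has no other bounded solution by a
maximum principle (`IsCrankNicolson.unique`).

Up to the last denominator, `P_N` is the product of the factors `(1 - a m) / (1 + a m)`, whose
logarithm is `-2 a m + O((a m)³)`. Three ranges of frequencies behave differently.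

* For `a N ≤ 1/2` (`abs_sub_gaussian_low`), `P_N` and `G` differ by `O(N⁻²)` times a Gaussian in
  `N θ`. This contributes `O(N⁻³)` to the integral.
* For `1/(2N) ≤ a ≤ 1` (`amplification_mid`), the factors with `a m ≤ 1` give exponential decay in
  `1/a` and the others are at most `(m - 1) / (m + 1)`, which telescopes to `O(N⁻²)`; the last
  denominator supplies one more power of `N`. This again contributes `O(N⁻³)`.
* For `a ≥ 1` (`amplification_high`), comparison with the harmonic sum gives `|P_N| ≤ N^{-1-2/a}`.
  Since `2/a ≥ (1 + (π - θ)²/π²) / λ²`, integration over `θ` yields `N^{-1-1/λ²} / √(log N)`. This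
  range matters exactly when `λ² > 1/2`, and then it dominates because `1/λ² < 2`.

With `h` proportional to `1/N` these are the asserted rates.
-/

namespace TimeChangedCN

/-! ### The amplification factor of the scheme -/

/-- The factor by which `n` steps of the scheme multiply a Fourier mode `e^{ijθ}`, as a function of
`a = λ² (1 - cos θ)`. -/
noncomputable def amplification (a : ℝ) (n : ℕ) : ℝ :=
  ∏ m ∈ Finset.range n, (1 - a * m) / (1 + a * (m + 1))

/-- The product of the factors `(1 - a m) / (1 + a m)`, which is the amplification factor up to its
last denominator. -/
noncomputable def cayleyProd (a : ℝ) (n : ℕ) : ℝ :=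
  ∏ m ∈ Finset.range n, (1 - a * m) / (1 + a * m)

lemma amplification_succ (a : ℝ) (n : ℕ) :
    amplification a (n + 1) = amplification a n * ((1 - a * n) / (1 + a * (n + 1))) :=
  Finset.prod_range_succ _ _

lemma cayleyProd_succ (a : ℝ) (n : ℕ) :
    cayleyProd a (n + 1) = cayleyProd a n * ((1 - a * n) / (1 + a * n)) :=
  Finset.prod_range_succ _ _

lemma amplification_eq {a : ℝ} (ha : 0 ≤ a) (n : ℕ) :
    amplification a n = cayleyProd a n / (1 + a * n) := by
  induction n with
  | zero => simp [amplification, cayleyProd]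
  | succ n ih =>
    rw [amplification_succ, cayleyProd_succ, ih]
    have h1 : 0 < 1 + a * n := by positivity
    have h2 : 0 < 1 + a * (n + 1) := by positivity
    push_cast
    field_simp

lemma abs_amplification_le_one {a : ℝ} (ha : 0 ≤ a) (n : ℕ) : |amplification a n| ≤ 1 := by
  rw [amplification, Finset.abs_prod]
  refine Finset.prod_le_one (fun _ _ => abs_nonneg _) fun m _ => ?_
  have h0 : 0 ≤ a * m := by positivity
  have h2 : 0 < 1 + a * (m + 1) := by positivity
  rw [abs_div, abs_of_pos h2, div_le_one h2, abs_le]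
  constructor <;> nlinarith

/-! ### Elementary inequalities -/

lemma cayley_le_exp {x : ℝ} (h0 : 0 ≤ x) : (1 - x) / (1 + x) ≤ Real.exp (-2 * x) := by
  rcases le_or_gt 1 x with h1 | h1
  · exact (div_nonpos_of_nonpos_of_nonneg (by linarith) (by linarith)).trans (Real.exp_pos _).le
  have hs := Real.hasSum_log_sub_log_of_abs_lt_one (x := x) (by rw [abs_of_nonneg h0]; exact h1)
  have h2 : 2 * x ≤ Real.log (1 + x) - Real.log (1 - x) := by
    have := hs.summable.sum_le_tsum {0} (fun i _ => by positivity)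
    rw [hs.tsum_eq] at this
    simpa using this
  rw [← Real.log_le_iff_le_exp (div_pos (by linarith) (by linarith)),
    Real.log_div (by linarith) (by linarith)]
  linarith

lemma exp_le_cayley {x : ℝ} (h0 : 0 ≤ x) (h1 : x ≤ 1 / 2) :
    Real.exp (-2 * x - 4 * x ^ 3) ≤ (1 - x) / (1 + x) := by
  rw [← Real.le_log_iff_exp_le (div_pos (by linarith) (by linarith)),
    Real.log_div (by linarith) (by linarith)]
  have hx : |x| < 1 := by rw [abs_of_nonneg h0]; linarith
  have e1 := (abs_le.1 (Real.abs_log_sub_add_sum_range_le hx 2)).1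
  have e2 := (abs_le.1 (Real.abs_log_sub_add_sum_range_le (x := -x) (by rwa [abs_neg]) 2)).2
  have e3 : |x| ^ (2 + 1) / (1 - |x|) ≤ 2 * x ^ 3 := by
    rw [abs_of_nonneg h0, div_le_iff₀ (by linarith)]
    norm_num only
    nlinarith [mul_nonneg (pow_nonneg h0 3) (by linarith : (0 : ℝ) ≤ 1 - 2 * x)]
  rw [abs_neg] at e2
  simp only [Finset.sum_range_succ, Finset.sum_range_zero, sub_neg_eq_add] at e1 e2
  norm_num at e1 e2 e3
  linarith

lemma abs_cayley_le_exp_inv {x : ℝ} (h1 : 1 ≤ x) :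
    |(1 - x) / (1 + x)| ≤ Real.exp (-2 / x) := by
  have h := cayley_le_exp (x := 1 / x) (by positivity)
  have hx : 0 < x := by linarith
  rw [abs_div, abs_of_nonpos (by linarith), abs_of_pos (by linarith : 0 < 1 + x)]
  convert h using 1
  · field_simp; ring
  · congr 1; ring

lemma pow_mul_exp_neg_le {x : ℝ} (hx : 0 ≤ x) (n : ℕ) :
    x ^ n * Real.exp (-x) ≤ n.factorial := by
  have h := Real.pow_div_factorial_le_exp x hx n
  have h3 : (0 : ℝ) < n.factorial := by positivity
  rw [div_le_iff₀ h3] at h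
  rw [Real.exp_neg, ← div_eq_mul_inv, div_le_iff₀ (Real.exp_pos x)]
  linarith

/-! ### Low frequencies -/

lemma cayleyProd_le_exp {a : ℝ} (ha : 0 ≤ a) (n : ℕ) (hn : ∀ m < n, a * m ≤ 1) :
    0 ≤ cayleyProd a n ∧ cayleyProd a n ≤ Real.exp (-(a * n * (n - 1))) := by
  induction n with
  | zero => simp [cayleyProd]
  | succ n ih =>
    obtain ⟨i0, i1⟩ := ih fun m hm => hn m (by omega)
    have hx := hn n (by omega)
    have h0 : 0 ≤ a * n := by positivity
    have hf : 0 ≤ (1 - a * n) / (1 + a * n) := div_nonneg (by linarith) (by linarith)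
    rw [cayleyProd_succ]
    refine ⟨mul_nonneg i0 hf, (mul_le_mul i1 (cayley_le_exp h0) hf (Real.exp_pos _).le).trans ?_⟩
    rw [← Real.exp_add]
    apply le_of_eq
    push_cast
    ring_nf

lemma exp_le_cayleyProd {a : ℝ} (ha : 0 ≤ a) (N : ℕ) (haN : a * N ≤ 1 / 2) (n : ℕ) (hn : n ≤ N) :
    Real.exp (-(a * n * (n - 1)) - 4 * n * (a * N) ^ 3) ≤ cayleyProd a n := by
  induction n with
  | zero => simp [cayleyProd]
  | succ n ih =>
    have i1 := ih (by omega)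
    have h0 : 0 ≤ a * n := by positivity
    have hnN : a * n ≤ a * N := mul_le_mul_of_nonneg_left (by exact_mod_cast (by omega)) ha
    rw [cayleyProd_succ]
    refine le_trans ?_
      (mul_le_mul i1 (exp_le_cayley h0 (by linarith)) (Real.exp_pos _).le ((Real.exp_pos _).le.trans i1))
    rw [← Real.exp_add, Real.exp_le_exp]
    have : (a * n) ^ 3 ≤ (a * N) ^ 3 := by gcongr
    push_cast
    nlinarith

/-- For `a N ≤ 1/2` the amplification factor is `e^{-y}` with `y = a N²`, up to a relative error
`O((y² + y³) / N²)`. -/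
lemma amplification_low {a : ℝ} (ha : 0 ≤ a) {N : ℕ} (haN : a * N ≤ 1 / 2) :
    Real.exp (-(a * N ^ 2)) * (1 - 4 * a ^ 3 * N ^ 4) ≤ amplification a N ∧
      amplification a N ≤ Real.exp (-(a * N ^ 2)) * (1 + (a * N) ^ 2) := by
  have h0 : 0 ≤ a * N := by positivity
  have hd : 0 < 1 + a * N := by positivity
  rw [amplification_eq ha]
  constructor
  · rw [le_div_iff₀ hd]
    refine le_trans ?_ (exp_le_cayleyProd ha N haN N le_rfl)
    have e1 := Real.add_one_le_exp (a * N)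
    have e2 := Real.add_one_le_exp (-(4 * a ^ 3 * N ^ 4))
    calc Real.exp (-(a * N ^ 2)) * (1 - 4 * a ^ 3 * N ^ 4) * (1 + a * N)
        ≤ Real.exp (-(a * N ^ 2)) * Real.exp (-(4 * a ^ 3 * N ^ 4)) * Real.exp (a * N) := by
          gcongr <;> linarith
      _ = _ := by
          rw [← Real.exp_add, ← Real.exp_add]
          congr 1
          ring
  · have hm : ∀ m < N, a * (m : ℝ) ≤ 1 := fun m hm => by
      have : a * m ≤ a * N := mul_le_mul_of_nonneg_left (by exact_mod_cast hm.le) ha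
      linarith
    rw [div_le_iff₀ hd]
    refine (cayleyProd_le_exp ha N hm).2.trans ?_
    have e : Real.exp (-(a * N * (N - 1))) = Real.exp (-(a * N ^ 2)) * Real.exp (a * N) := by
      rw [← Real.exp_add]; congr 1; ring
    rw [e, mul_assoc]
    gcongr
    have := Real.abs_exp_sub_one_sub_id_le (x := a * N) (by rw [abs_of_nonneg h0]; linarith)
    have := (abs_le.1 this).2
    nlinarith [pow_nonneg h0 3]

/-! ### Intermediate and high frequencies -/

lemma amplification_mid {a : ℝ} (ha0 : 0 < a) (ha1 : a ≤ 1) {N : ℕ} (hN : 2 ≤ N)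
    (haN : 1 / 2 ≤ a * N) : |amplification a N| ≤ 384 / N ^ 3 := by
  have hN' : (2 : ℝ) ≤ N := by exact_mod_cast hN
  have hd : 0 < 1 + a * N := by positivity
  rw [amplification_eq ha0.le, abs_div, abs_of_pos hd]
  set m₀ := ⌈1 / a⌉₊ with hm₀
  have hm1 : 1 ≤ a * m₀ := by
    have := Nat.le_ceil (1 / a)
    rw [div_le_iff₀ ha0] at this
    linarith
  have hlow : ∀ m < m₀, a * (m : ℝ) ≤ 1 := fun m hm => by
    have := (Nat.lt_ceil.1 hm).le
    rw [le_div_iff₀ ha0] at this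
    linarith
  have hm₀1 : (1 : ℝ) ≤ m₀ := by nlinarith [(Nat.cast_nonneg m₀ : (0 : ℝ) ≤ m₀)]
  rcases le_total N m₀ with h | h
  · obtain ⟨i0, i1⟩ := cayleyProd_le_exp ha0.le N fun m hm => hlow m (by omega)
    rw [abs_of_nonneg i0, div_le_div_iff₀ hd (by positivity)]
    have e1 : cayleyProd a N ≤ Real.exp (-((N : ℝ) / 4)) := by
      refine i1.trans (Real.exp_le_exp.2 ?_)
      nlinarith
    have e2 := pow_mul_exp_neg_le (x := (N : ℝ) / 4) (by positivity) 3
    norm_num [Nat.factorial] at e2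
    have e3 : cayleyProd a N * (N : ℝ) ^ 3 ≤ Real.exp (-((N : ℝ) / 4)) * N ^ 3 := by gcongr
    nlinarith
  · -- Beyond `m₀` the factors are at most `(m - 1) / (m + 1)`, whose product telescopes.
    have key : ∀ n, m₀ ≤ n → |cayleyProd a n| * (n * (n - 1)) ≤
        Real.exp (-((m₀ : ℝ) - 1)) * m₀ ^ 2 := by
      intro n hn
      induction n, hn using Nat.le_induction with
      | base =>
        obtain ⟨i0, i1⟩ := cayleyProd_le_exp ha0.le m₀ hlow
        rw [abs_of_nonneg i0]
        refine mul_le_mul (i1.trans (Real.exp_le_exp.2 ?_)) (by nlinarith) (by nlinarith)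
          (Real.exp_pos _).le
        nlinarith
      | succ n hn ih =>
        have hn' : (m₀ : ℝ) ≤ n := by exact_mod_cast hn
        have han : 1 ≤ a * n := hm1.trans (mul_le_mul_of_nonneg_left hn' ha0.le)
        refine le_trans ?_ ih
        rw [cayleyProd_succ, abs_mul, mul_assoc]
        refine mul_le_mul_of_nonneg_left ?_ (abs_nonneg _)
        rw [abs_div, abs_of_nonpos (by linarith), abs_of_pos (by linarith : 0 < 1 + a * n),
          div_mul_eq_mul_div, div_le_iff₀ (by linarith)]
        push_cast
        have hn0 : (0 : ℝ) ≤ n := by positivity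
        have : (a * n - 1) * (n + 1) ≤ (n - 1) * (1 + a * n) := by nlinarith
        nlinarith
    have hk := key N h
    have e2 := pow_mul_exp_neg_le (x := (m₀ : ℝ)) (by positivity) 3
    norm_num [Nat.factorial] at e2
    have e3 : Real.exp (-((m₀ : ℝ) - 1)) = Real.exp 1 * Real.exp (-(m₀ : ℝ)) := by
      rw [← Real.exp_add]; congr 1; ring
    have e4 : Real.exp 1 < 3 := Real.exp_one_lt_three
    have hm₀0 : (0 : ℝ) < m₀ := by linarith
    have e5 : |cayleyProd a N| * (N * (N - 1)) * m₀ ≤ 18 := by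
      calc _ ≤ (Real.exp (-((m₀ : ℝ) - 1)) * m₀ ^ 2) * m₀ := by gcongr
        _ = Real.exp 1 * ((m₀ : ℝ) ^ 3 * Real.exp (-(m₀ : ℝ))) := by rw [e3]; ring
        _ ≤ 3 * 6 := by gcongr
        _ = 18 := by norm_num
    have e6 : |cayleyProd a N| * N ^ 2 * m₀ ≤ 36 := by
      have : (N : ℝ) ^ 2 ≤ 2 * (N * (N - 1)) := by nlinarith
      have h7 : 0 ≤ |cayleyProd a N| * m₀ := by positivity
      nlinarith [mul_le_mul_of_nonneg_left this h7]
    rw [div_le_div_iff₀ hd (by positivity)]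
    have h8 : |cayleyProd a N| * N ^ 3 ≤ (|cayleyProd a N| * N ^ 2 * m₀) * (a * N) := by
      have : 0 ≤ |cayleyProd a N| * (N : ℝ) ^ 3 := by positivity
      nlinarith [mul_le_mul_of_nonneg_left hm1 this]
    have h9 : 0 ≤ a * N := by positivity
    nlinarith [mul_le_mul_of_nonneg_right e6 h9]

lemma amplification_high {a : ℝ} (ha : 1 ≤ a) {N : ℕ} (hN : 1 ≤ N) :
    |amplification a N| ≤ Real.exp (-(2 / a) * Real.log N) / N := by
  have ha0 : 0 < a := by linarith
  have hN' : (1 : ℝ) ≤ N := by exact_mod_cast hN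
  have hd : 0 < 1 + a * N := by positivity
  have key : |cayleyProd a N| ≤ Real.exp (-(2 / a) * Real.log N) := by
    clear hd hN'
    induction N, hN using Nat.le_induction with
    | base => simp [cayleyProd]
    | succ n hn ih =>
      have hn' : (1 : ℝ) ≤ n := by exact_mod_cast hn
      have hn0 : (0 : ℝ) < n := by linarith
      rw [cayleyProd_succ, abs_mul]
      refine (mul_le_mul ih (abs_cayley_le_exp_inv (by nlinarith)) (abs_nonneg _)
        (Real.exp_pos _).le).trans ?_
      rw [← Real.exp_add, Real.exp_le_exp]
      have e1 : Real.log (n + 1 : ℝ) - Real.log n ≤ 1 / n := by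
        rw [← Real.log_div (by linarith) (by linarith)]
        refine (Real.log_le_sub_one_of_pos (by positivity)).trans (le_of_eq ?_)
        field_simp
        ring
      have e2 : (2 / a) * (Real.log (n + 1 : ℝ) - Real.log n) ≤ (2 / a) * (1 / n) := by gcongr
      have e3 : -2 / (a * n) = -((2 / a) * (1 / n)) := by field_simp
      rw [e3]
      push_cast
      linarith
  rw [amplification_eq ha0.le, abs_div, abs_of_pos hd]
  have : (N : ℝ) ≤ 1 + a * N := by nlinarith
  gcongr

/-! ### The numerical solution as a Fourier integral -/

/-- The solution of the scheme with `k / h = lam`: the discrete Dirac datum is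
`(π h)⁻¹ ∫_0^π cos (jθ) dθ`, and each mode is multiplied by its amplification factor. -/
noncomputable def fourierSolution (lam h : ℝ) (n : ℕ) (j : ℤ) : ℝ :=
  1 / (Real.pi * h) *
    ∫ θ in (0 : ℝ)..Real.pi, Real.cos (j * θ) * amplification (lam ^ 2 * (1 - Real.cos θ)) n

lemma symbol_nonneg (lam θ : ℝ) : 0 ≤ lam ^ 2 * (1 - Real.cos θ) :=
  mul_nonneg (sq_nonneg _) (by linarith [Real.cos_le_one θ])

lemma continuous_amplification (lam : ℝ) (n : ℕ) :
    Continuous fun θ : ℝ => amplification (lam ^ 2 * (1 - Real.cos θ)) n := by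
  unfold amplification
  refine continuous_finsetProd _ fun m _ => Continuous.div (by fun_prop) (by fun_prop) fun θ => ?_
  have := symbol_nonneg lam θ
  positivity

lemma fourierSolution_zero (lam h : ℝ) (j : ℤ) :
    fourierSolution lam h 0 j = if j = 0 then 1 / h else 0 := by
  simp only [fourierSolution, amplification, Finset.range_zero, Finset.prod_empty, mul_one]
  split_ifs with hj
  · subst hj
    have := Real.pi_pos.ne'
    simp [field]
  · have hj' : (j : ℝ) ≠ 0 := by exact_mod_cast hj
    rw [intervalIntegral.integral_comp_mul_left (fun x => Real.cos x) hj']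
    simp [Real.sin_int_mul_pi]

lemma fourierSolution_bounded {h : ℝ} (hh : 0 < h) (lam : ℝ) (n : ℕ) (j : ℤ) :
    |fourierSolution lam h n j| ≤ 1 / h := by
  have hπ := Real.pi_pos
  have hI := intervalIntegral.norm_integral_le_of_norm_le_const (a := 0) (b := Real.pi) (C := 1)
    (f := fun θ => Real.cos (j * θ) * amplification (lam ^ 2 * (1 - Real.cos θ)) n) fun θ _ => by
      rw [norm_mul]
      exact mul_le_one₀ (Real.abs_cos_le_one _) (norm_nonneg _)
        (abs_amplification_le_one (symbol_nonneg lam θ) n)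
  rw [fourierSolution, abs_mul, abs_of_pos (by positivity)]
  rw [Real.norm_eq_abs, sub_zero, abs_of_pos hπ, one_mul] at hI
  calc _ ≤ 1 / (Real.pi * h) * Real.pi := by gcongr
    _ = 1 / h := by field_simp

lemma centralDiff_fourierSolution (lam h : ℝ) (n : ℕ) (j : ℤ) :
    centralDiff h (fourierSolution lam h n) j = 1 / (Real.pi * h) * (-2 / h ^ 2 *
      ∫ θ in (0 : ℝ)..Real.pi,
        (1 - Real.cos θ) * (Real.cos (j * θ) * amplification (lam ^ 2 * (1 - Real.cos θ)) n)) := by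
  have hc := continuous_amplification lam n
  have hi : ∀ i : ℤ, IntervalIntegrable
      (fun θ => Real.cos (i * θ) * amplification (lam ^ 2 * (1 - Real.cos θ)) n)
      MeasureTheory.volume 0 Real.pi := fun i =>
    Continuous.intervalIntegrable (by fun_prop) _ _
  have e : (∫ θ in (0 : ℝ)..Real.pi, -2 *
        ((1 - Real.cos θ) * (Real.cos (j * θ) * amplification (lam ^ 2 * (1 - Real.cos θ)) n))) =
      (∫ θ in (0 : ℝ)..Real.pi,
        Real.cos ((j + 1 : ℤ) * θ) * amplification (lam ^ 2 * (1 - Real.cos θ)) n)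
      - 2 * (∫ θ in (0 : ℝ)..Real.pi,
        Real.cos (j * θ) * amplification (lam ^ 2 * (1 - Real.cos θ)) n)
      + ∫ θ in (0 : ℝ)..Real.pi,
        Real.cos ((j - 1 : ℤ) * θ) * amplification (lam ^ 2 * (1 - Real.cos θ)) n := by
    rw [← intervalIntegral.integral_const_mul, ← intervalIntegral.integral_sub (hi _)
      ((hi _).const_mul _), ← intervalIntegral.integral_add ((hi _).sub ((hi _).const_mul _)) (hi _)]
    refine intervalIntegral.integral_congr fun θ _ => ?_
    push_cast
    simp only [add_mul, sub_mul, Real.cos_add, Real.cos_sub, one_mul]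
    ring
  rw [intervalIntegral.integral_const_mul] at e
  rw [centralDiff]
  simp only [fourierSolution]
  rw [show ∀ x : ℝ, -2 / h ^ 2 * x = (-2 * x) / h ^ 2 from fun x => by ring, e]
  ring

lemma isCrankNicolson_fourierSolution {lam k h : ℝ} (hk : 0 < k) (hh : 0 < h) (hkh : k = lam * h)
    (N : ℕ) : IsCrankNicolson k h N (fourierSolution lam h) where
  initial := fourierSolution_zero lam h
  bounded n _ := ⟨1 / h, fourierSolution_bounded hh lam n⟩
  step n _ j := by
    have hi : ∀ n : ℕ, IntervalIntegrable
        (fun θ => Real.cos (j * θ) * amplification (lam ^ 2 * (1 - Real.cos θ)) n)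
        MeasureTheory.volume 0 Real.pi := fun n => by
      have hc := continuous_amplification lam n
      exact Continuous.intervalIntegrable (by fun_prop) _ _
    have hi' : ∀ n : ℕ, IntervalIntegrable
        (fun θ => (1 - Real.cos θ) *
          (Real.cos (j * θ) * amplification (lam ^ 2 * (1 - Real.cos θ)) n))
        MeasureTheory.volume 0 Real.pi := fun n => by
      have hc := continuous_amplification lam n
      exact Continuous.intervalIntegrable (by fun_prop) _ _
    have e : (∫ θ in (0 : ℝ)..Real.pi,
          Real.cos (j * θ) * amplification (lam ^ 2 * (1 - Real.cos θ)) (n + 1)) -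
        (∫ θ in (0 : ℝ)..Real.pi,
          Real.cos (j * θ) * amplification (lam ^ 2 * (1 - Real.cos θ)) n) =
        (-lam ^ 2 * n) * (∫ θ in (0 : ℝ)..Real.pi, (1 - Real.cos θ) *
          (Real.cos (j * θ) * amplification (lam ^ 2 * (1 - Real.cos θ)) n)) +
        (-lam ^ 2 * (n + 1)) * ∫ θ in (0 : ℝ)..Real.pi, (1 - Real.cos θ) *
          (Real.cos (j * θ) * amplification (lam ^ 2 * (1 - Real.cos θ)) (n + 1)) := by
      rw [← intervalIntegral.integral_const_mul, ← intervalIntegral.integral_const_mul,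
        ← intervalIntegral.integral_sub (hi _) (hi _),
        ← intervalIntegral.integral_add ((hi' _).const_mul _) ((hi' _).const_mul _)]
      refine intervalIntegral.integral_congr fun θ _ => ?_
      have h1 := symbol_nonneg lam θ
      have h2 : 0 < 1 + lam ^ 2 * (1 - Real.cos θ) * (n + 1) := by positivity
      simp only [amplification_succ]
      field_simp
      ring
    rw [centralDiff_fourierSolution, centralDiff_fourierSolution, fourierSolution, fourierSolution,
      ← mul_sub, e, hkh]
    rw [hkh] at hk
    have hl : lam ≠ 0 := fun h0 => by simp [h0] at hk
    have hπ := Real.pi_pos.ne'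
    push_cast
    field_simp

/-! ### Uniqueness -/

/-- An implicit step has only the zero solution among the bounded grid functions with zero right
hand side, because `(1 + 2r) sup |W| ≤ 2r sup |W|`. -/
lemma eq_zero_of_implicit {r : ℝ} (hr : 0 ≤ r) {W : ℤ → ℝ} {B : ℝ} (hB : ∀ j, |W j| ≤ B)
    (hW : ∀ j, W j = r * (W (j + 1) - 2 * W j + W (j - 1))) (j : ℤ) : W j = 0 := by
  have hbdd : BddAbove (Set.range fun j => |W j|) := ⟨B, by rintro _ ⟨j, rfl⟩; exact hB j⟩
  set S := ⨆ j, |W j| with hS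
  have hle : ∀ j, |W j| ≤ S := fun j => le_ciSup hbdd j
  have h1 : ∀ j, |W j| ≤ 2 * r * S / (1 + 2 * r) := fun j => by
    rw [le_div_iff₀ (by positivity)]
    have e : W j * (1 + 2 * r) = r * (W (j + 1) + W (j - 1)) := by linarith [hW j]
    have e' := congrArg abs e
    rw [abs_mul, abs_mul, abs_of_pos (by positivity : 0 < 1 + 2 * r), abs_of_nonneg hr] at e'
    rw [e']
    have := abs_add_le (W (j + 1)) (W (j - 1))
    nlinarith [hle (j + 1), hle (j - 1)]
  have h2 : S ≤ 2 * r * S / (1 + 2 * r) := ciSup_le h1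
  rw [le_div_iff₀ (by positivity)] at h2
  exact abs_eq_zero.1 (le_antisymm ((hle j).trans (by linarith)) (abs_nonneg _))

lemma IsCrankNicolson.unique {k h : ℝ} (hk : 0 < k) {N : ℕ} {U V : ℕ → ℤ → ℝ}
    (hU : IsCrankNicolson k h N U) (hV : IsCrankNicolson k h N V) (n : ℕ) (hn : n ≤ N) :
    V n = U n := by
  induction n with
  | zero => funext j; rw [hU.initial, hV.initial]
  | succ n ih =>
    have ih := ih (by omega)
    obtain ⟨B, hB⟩ := hU.bounded (n + 1) hn
    obtain ⟨B', hB'⟩ := hV.bounded (n + 1) hn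
    funext j
    refine sub_eq_zero.1 (eq_zero_of_implicit (W := fun j => V (n + 1) j - U (n + 1) j)
      (r := 1 / 2 * (((n + 1 : ℕ) : ℝ) * k) / h ^ 2 * k) (by positivity)
      (fun j => (abs_sub _ _).trans (add_le_add (hB' j) (hB j))) (fun j => ?_) j)
    have e1 := hU.step n (by omega) j
    have e2 := hV.step n (by omega) j
    rw [ih] at e2
    rw [div_eq_iff hk.ne'] at e1 e2
    simp only [centralDiff] at e1 e2
    have := congrArg₂ (· - ·) e2 e1
    calc _ = (V (n + 1) j - U n j) - (U (n + 1) j - U n j) := by ring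
      _ = _ := by rw [this]; ring

/-! ### The heat kernel -/

lemma hasDerivAt_heatSolution_space (t x : ℝ) :
    HasDerivAt (heatSolution t) (-x / t * heatSolution t x) x := by
  have h1 : HasDerivAt (fun x : ℝ => -x ^ 2 / (2 * t)) (-x / t) x := by
    refine ((hasDerivAt_pow 2 x).neg.div_const (2 * t)).congr_deriv ?_
    rw [neg_div, neg_div, Nat.cast_ofNat, mul_div_mul_left _ _ two_ne_zero, pow_one]
  refine (h1.exp.const_mul (1 / Real.sqrt (2 * Real.pi * t))).congr_deriv ?_
  rw [heatSolution]
  ring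

lemma iteratedDeriv_two_heatSolution (t x : ℝ) :
    iteratedDeriv 2 (heatSolution t) x = (x ^ 2 / t ^ 2 - 1 / t) * heatSolution t x := by
  have e : deriv (heatSolution t) = fun x => -x / t * heatSolution t x :=
    funext fun x => (hasDerivAt_heatSolution_space t x).deriv
  rw [iteratedDeriv_succ, iteratedDeriv_one, e]
  have h1 : HasDerivAt (fun x : ℝ => -x / t) (-1 / t) x := (hasDerivAt_id x).neg.div_const t
  refine (h1.mul (hasDerivAt_heatSolution_space t x)).deriv.trans ?_
  ring

lemma hasDerivAt_heatSolution_time {t : ℝ} (ht : 0 < t) (x : ℝ) :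
    HasDerivAt (fun s => heatSolution s x) (1 / 2 * iteratedDeriv 2 (heatSolution t) x) t := by
  have hπ := Real.pi_pos
  have hp : 0 < 2 * Real.pi * t := by positivity
  have h1 : HasDerivAt (fun s : ℝ => 2 * Real.pi * s) (2 * Real.pi) t := by
    simpa using (hasDerivAt_id t).const_mul (2 * Real.pi)
  have h2 := (h1.sqrt hp.ne').inv (Real.sqrt_pos.2 hp).ne'
  have h3 : HasDerivAt (fun s : ℝ => -x ^ 2 / (2 * s)) (x ^ 2 / (2 * t ^ 2)) t := by
    have h := ((hasDerivAt_inv ht.ne').const_mul (-x ^ 2 / 2)).congr_deriv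
      (g' := x ^ 2 / (2 * t ^ 2)) (by field_simp)
    refine h.congr_of_eventuallyEq (Eventually.of_forall fun s => ?_)
    simp only [div_eq_mul_inv, mul_inv]
    ring
  rw [iteratedDeriv_two_heatSolution]
  simp only [heatSolution, one_div]
  refine (h2.mul h3.exp).congr_deriv ?_
  simp only [Real.sq_sqrt hp.le, Pi.inv_apply]
  have hs := (Real.sqrt_pos.2 hp).ne'
  field_simp
  ring

lemma integrable_heatSolution {t : ℝ} (ht : 0 < t) : MeasureTheory.Integrable (heatSolution t) := by
  refine ((integrable_exp_neg_mul_sq (b := 1 / (2 * t)) (by positivity)).const_mul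
    (1 / Real.sqrt (2 * Real.pi * t))).congr (Eventually.of_forall fun x => ?_)
  simp only [heatSolution]
  ring_nf

lemma sqrt_mul_heatSolution {t : ℝ} (ht : 0 < t) (y : ℝ) :
    Real.sqrt t * heatSolution t (Real.sqrt t * y) = heatSolution 1 y := by
  simp only [heatSolution]
  rw [mul_pow, Real.sq_sqrt ht.le, Real.sqrt_mul' _ ht.le, mul_one]
  have hs := (Real.sqrt_pos.2 ht).ne'
  have e : -(t * y ^ 2) / (2 * t) = -y ^ 2 / (2 * 1) := by field_simp
  rw [e, ← mul_assoc]
  congr 1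
  field_simp

lemma integral_heatSolution_one : ∫ y, heatSolution 1 y = 1 := by
  have e : heatSolution 1 = fun y =>
      1 / Real.sqrt (2 * Real.pi) * Real.exp (-(1 / 2) * y ^ 2) := by
    funext y
    simp only [heatSolution]
    ring_nf
  have hp : 0 < 2 * Real.pi := by positivity
  rw [e, MeasureTheory.integral_const_mul, integral_gaussian]
  have := (Real.sqrt_pos.2 hp).ne'
  rw [show Real.pi / (1 / 2) = 2 * Real.pi by ring]
  field_simp

lemma tendsto_integral_heatSolution (φ : ℝ → ℝ) (hφ : Continuous φ) (hb : ∃ B : ℝ, ∀ x, |φ x| ≤ B) :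
    Tendsto (fun t => ∫ x, heatSolution t x * φ x) (𝓝[>] 0) (𝓝 (φ 0)) := by
  obtain ⟨B, hB⟩ := hb
  have hint := integrable_heatSolution one_pos
  -- The substitution `x = √t y` makes the kernel independent of `t`.
  have hsub : ∀ t : ℝ, 0 < t → ∫ x, heatSolution t x * φ x =
      ∫ y, heatSolution 1 y * φ (Real.sqrt t * y) := fun t ht => by
    have hs := Real.sqrt_pos.2 ht
    have h := MeasureTheory.Measure.integral_comp_mul_left
      (fun x => heatSolution t x * φ x) (Real.sqrt t)
    rw [abs_of_pos (by positivity), smul_eq_mul, eq_inv_mul_iff_mul_eq₀ hs.ne',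
      ← MeasureTheory.integral_const_mul] at h
    rw [← h]
    exact MeasureTheory.integral_congr_ae (Eventually.of_forall fun y => by
      simp only [← sqrt_mul_heatSolution ht y]; ring)
  have hlim : φ 0 = ∫ y, heatSolution 1 y * φ 0 := by
    rw [MeasureTheory.integral_mul_const, integral_heatSolution_one, one_mul]
  rw [hlim]
  refine Tendsto.congr' (f₁ := fun t => ∫ y, heatSolution 1 y * φ (Real.sqrt t * y))
    (eventually_nhdsWithin_of_forall fun t ht => (hsub t ht).symm) ?_
  refine MeasureTheory.tendsto_integral_filter_of_dominated_convergence
    (fun y => |heatSolution 1 y| * B) (Eventually.of_forall fun t => ?_)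
    (Eventually.of_forall fun t => Eventually.of_forall fun y => ?_) (hint.abs.mul_const B)
    (Eventually.of_forall fun y => ?_)
  · exact hint.aestronglyMeasurable.mul (by fun_prop : Continuous fun y =>
      φ (Real.sqrt t * y)).aestronglyMeasurable
  · rw [Real.norm_eq_abs, abs_mul]
    exact mul_le_mul_of_nonneg_left (hB _) (abs_nonneg _)
  · refine Tendsto.const_mul _ ?_
    have : Continuous fun t : ℝ => φ (Real.sqrt t * y) := by fun_prop
    have h := this.tendsto 0
    simp only [Real.sqrt_zero, zero_mul] at h
    exact h.mono_left nhdsWithin_le_nhds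

lemma solves_heatSolution : SolvesWithDiracData (fun _ => 1 / 2) heatSolution where
  smooth_space t _ := by
    unfold heatSolution
    fun_prop
  equation t ht x := hasDerivAt_heatSolution_time ht x
  integrable t ht := integrable_heatSolution ht
  initial := tendsto_integral_heatSolution

lemma solves_timeChangedSolution : SolvesWithDiracData (fun τ => τ) timeChangedSolution where
  smooth_space τ hτ := solves_heatSolution.smooth_space (τ ^ 2) (by positivity)
  equation τ hτ x := by
    have h := HasDerivAt.comp (h₂ := fun s => heatSolution s x) (h := fun τ : ℝ => τ ^ 2) τ
      (hasDerivAt_heatSolution_time (pow_pos hτ 2) x) (hasDerivAt_pow 2 τ)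
    refine h.congr_deriv ?_
    change _ = τ * iteratedDeriv 2 (heatSolution (τ ^ 2)) x
    push_cast
    ring
  integrable τ hτ := integrable_heatSolution (pow_pos hτ 2)
  initial φ hφ hb := by
    refine (tendsto_integral_heatSolution φ hφ hb).comp
      (tendsto_nhdsWithin_iff.2 ⟨?_, eventually_nhdsWithin_of_forall fun τ hτ =>
        Set.mem_Ioi.2 (pow_pos hτ 2)⟩)
    have : Continuous fun τ : ℝ => τ ^ 2 := by fun_prop
    have h := this.tendsto 0
    simp only [ne_eq, OfNat.ofNat_ne_zero, not_false_eq_true, zero_pow] at h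
    exact h.mono_left nhdsWithin_le_nhds

/-- The cosine transform of a Gaussian. -/
lemma integral_cos_mul_gaussian {b : ℝ} (hb : 0 < b) (t : ℝ) :
    ∫ θ in Set.Ioi (0 : ℝ), Real.cos (t * θ) * Real.exp (-b * θ ^ 2) =
      Real.sqrt (Real.pi / b) / 2 * Real.exp (-t ^ 2 / (4 * b)) := by
  have h := fourierIntegral_gaussian (b := (b : ℂ)) (by simpa using hb) (t : ℂ)
  have h' := congrArg Complex.re h
  have hint : MeasureTheory.Integrable fun x : ℝ =>
      Complex.exp (Complex.I * t * x) * Complex.exp (-b * x ^ 2) := by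
    refine (integrable_cexp_quadratic (b := (b : ℂ)) (by simpa using hb) (Complex.I * t) 0).congr
      (Eventually.of_forall fun x => ?_)
    simp only [← Complex.exp_add]
    ring_nf
  have hre : ∀ x : ℝ, (Complex.exp (Complex.I * t * x) * Complex.exp (-b * x ^ 2)).re =
      Real.cos (t * |x|) * Real.exp (-b * |x| ^ 2) := fun x => by
    have e1 : Complex.exp (-b * x ^ 2) = (Real.exp (-b * x ^ 2) : ℝ) := by push_cast; rfl
    have e2 : Complex.I * t * x = ((t * x : ℝ) : ℂ) * Complex.I := by push_cast; ring
    rw [e1, e2, Complex.re_mul_ofReal, Complex.exp_ofReal_mul_I_re, sq_abs]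
    congr 1
    rcases abs_choice x with hx | hx <;> simp [hx]
  have hl : (∫ x : ℝ, Complex.exp (Complex.I * t * x) * Complex.exp (-b * x ^ 2)).re =
      ∫ x : ℝ, Real.cos (t * |x|) * Real.exp (-b * |x| ^ 2) := by
    rw [← MeasureTheory.integral_congr_ae (Eventually.of_forall hre)]
    exact (integral_re hint).symm
  have hr : ((Real.pi / b : ℂ) ^ (1 / 2 : ℂ) * Complex.exp (-t ^ 2 / (4 * b))).re =
      Real.sqrt (Real.pi / b) * Real.exp (-t ^ 2 / (4 * b)) := by
    have e1 : (Real.pi / b : ℂ) ^ (1 / 2 : ℂ) = (Real.sqrt (Real.pi / b) : ℝ) := by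
      rw [Real.sqrt_eq_rpow, Complex.ofReal_cpow (by positivity)]
      push_cast
      rfl
    have e2 : Complex.exp (-t ^ 2 / (4 * b)) = (Real.exp (-t ^ 2 / (4 * b)) : ℝ) := by
      push_cast
      rfl
    rw [e1, e2, ← Complex.ofReal_mul, Complex.ofReal_re]
  rw [hl, hr, integral_comp_abs (f := fun x => Real.cos (t * x) * Real.exp (-b * x ^ 2))] at h'
  linarith

lemma heatSolution_eq_integral {T h : ℝ} (hT : 0 < T) (hh : 0 < h) (j : ℤ) :
    heatSolution T (j * h) = 1 / (Real.pi * h) *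
      ∫ θ in Set.Ioi (0 : ℝ), Real.cos (j * θ) * Real.exp (-(T / (2 * h ^ 2)) * θ ^ 2) := by
  have hπ := Real.pi_pos
  rw [integral_cos_mul_gaussian (by positivity), heatSolution]
  have e1 : -(j * h) ^ 2 / (2 * T) = -(j : ℝ) ^ 2 / (4 * (T / (2 * h ^ 2))) := by
    field_simp
    ring
  have e2 : Real.pi / (T / (2 * h ^ 2)) = (2 * Real.pi * h) ^ 2 / (2 * Real.pi * T) := by
    field_simp
  rw [e1, e2, Real.sqrt_div (by positivity), Real.sqrt_sq (by positivity)]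
  have := (Real.sqrt_pos.2 (by positivity : 0 < 2 * Real.pi * T)).ne'
  field_simp

/-! ### Comparison of the symbols -/

lemma sq_div_two_sub_le (θ : ℝ) : θ ^ 2 / 2 - (1 - Real.cos θ) ≤ θ ^ 4 / 2 := by
  rcases le_total |θ| 1 with h | h
  · have h1 := (abs_le.1 (Real.cos_bound h)).2
    rw [Even.pow_abs (by decide)] at h1
    nlinarith [sq_nonneg (θ ^ 2)]
  · have h1 : 1 ≤ θ ^ 2 := by rw [← sq_abs]; nlinarith
    have h2 := Real.cos_le_one θ
    nlinarith

lemma two_div_pi_sq_mul_le {θ : ℝ} (h0 : 0 ≤ θ) (hπ : θ ≤ Real.pi) :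
    2 / Real.pi ^ 2 * θ ^ 2 ≤ 1 - Real.cos θ := by
  have := Real.cos_le_one_sub_mul_cos_sq (x := θ) (by rwa [abs_of_nonneg h0])
  linarith

/-- For `a N ≤ 1/2` both the amplification factor and the exact factor `e^{-λ²N²θ²/2}` are
`e^{-y}`, `y = a N²`, up to a relative error `O((y² + y³) / N²)`. -/
lemma abs_sub_gaussian_low {lam : ℝ} (hlam : 0 < lam) {N : ℕ} (hN : 1 ≤ N) {θ : ℝ} (h0 : 0 ≤ θ)
    (hθ : θ ≤ Real.pi) (haN : lam ^ 2 * (1 - Real.cos θ) * N ≤ 1 / 2) :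
    |amplification (lam ^ 2 * (1 - Real.cos θ)) N - Real.exp (-(lam ^ 2 * N ^ 2 / 2) * θ ^ 2)| ≤
      (200 + Real.pi ^ 4 / lam ^ 2) / N ^ 2 * Real.exp (-(lam ^ 2 * N ^ 2 / Real.pi ^ 2) * θ ^ 2) := by
  have hπ := Real.pi_pos
  have hN0 : (0 : ℝ) < N := by exact_mod_cast hN
  have ha := symbol_nonneg lam θ
  obtain ⟨l1, l2⟩ := amplification_low ha haN
  have hJ := two_div_pi_sq_mul_le h0 hθ
  have hQ := sq_div_two_sub_le θ
  have hc := Real.one_sub_sq_div_two_le_cos (x := θ)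
  set q := 1 - Real.cos θ with hq
  have hq0 : 0 ≤ q := by linarith [Real.cos_le_one θ]
  set y := lam ^ 2 * q * N ^ 2 with hy
  have hy0 : 0 ≤ y := by positivity
  set w := lam ^ 2 * N ^ 2 / 2 * θ ^ 2 with hw
  have hyw : y ≤ w := by
    have : q ≤ θ ^ 2 / 2 := by linarith
    calc y = lam ^ 2 * N ^ 2 * q := by rw [hy]; ring
      _ ≤ lam ^ 2 * N ^ 2 * (θ ^ 2 / 2) := by gcongr
      _ = w := by rw [hw]; ring
  have hwy : w - y ≤ Real.pi ^ 4 / (8 * lam ^ 2) * y ^ 2 / N ^ 2 := by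
    have h1 : θ ^ 2 ≤ Real.pi ^ 2 / 2 * q := by
      rw [div_mul_eq_mul_div, div_le_iff₀ (by positivity)] at hJ
      linarith
    have h2 : θ ^ 4 ≤ (Real.pi ^ 2 / 2 * q) ^ 2 := by
      rw [show θ ^ 4 = (θ ^ 2) ^ 2 by ring]
      gcongr
    calc w - y = lam ^ 2 * N ^ 2 * (θ ^ 2 / 2 - q) := by rw [hw, hy]; ring
      _ ≤ lam ^ 2 * N ^ 2 * ((Real.pi ^ 2 / 2 * q) ^ 2 / 2) := by
        gcongr
        linarith
      _ = _ := by rw [hy]; field_simp; ring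
  have hyJ : lam ^ 2 * N ^ 2 / Real.pi ^ 2 * θ ^ 2 ≤ y / 2 := by
    calc _ = lam ^ 2 * N ^ 2 * (2 / Real.pi ^ 2 * θ ^ 2) / 2 := by ring
      _ ≤ lam ^ 2 * N ^ 2 * q / 2 := by gcongr
      _ = y / 2 := by rw [hy]; ring
  have e1 : (lam ^ 2 * q * N) ^ 2 = y ^ 2 / N ^ 2 := by rw [hy]; field_simp
  have e2 : 4 * (lam ^ 2 * q) ^ 3 * N ^ 4 = 4 * y ^ 3 / N ^ 2 := by rw [hy]; field_simp
  rw [e1] at l2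
  rw [e2] at l1
  have hG1 : Real.exp (-w) ≤ Real.exp (-y) := Real.exp_le_exp.2 (by linarith)
  have hG2 : Real.exp (-y) * (1 - (w - y)) ≤ Real.exp (-w) := by
    have := Real.add_one_le_exp (-(w - y))
    calc _ ≤ Real.exp (-y) * Real.exp (-(w - y)) := by gcongr; linarith
      _ = _ := by rw [← Real.exp_add]; congr 1; ring
  have hE := Real.exp_pos (-y)
  have p2 := pow_mul_exp_neg_le (x := y / 2) (by positivity) 2
  have p3 := pow_mul_exp_neg_le (x := y / 2) (by positivity) 3
  norm_num [Nat.factorial] at p2 p3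
  have hEE : Real.exp (-y) = Real.exp (-(y / 2)) * Real.exp (-(y / 2)) := by
    rw [← Real.exp_add]; congr 1; ring
  have hmain : Real.exp (-y) * ((1 + Real.pi ^ 4 / (8 * lam ^ 2)) * y ^ 2 / N ^ 2 + 4 * y ^ 3 / N ^ 2)
      ≤ (200 + Real.pi ^ 4 / lam ^ 2) / N ^ 2 * Real.exp (-(y / 2)) := by
    set E := Real.exp (-(y / 2)) with hE'
    have hEp : 0 < E := Real.exp_pos _
    set K := Real.pi ^ 4 / lam ^ 2 with hK
    have hK0 : 0 < K := by positivity
    have hKK : Real.pi ^ 4 / (8 * lam ^ 2) = K / 8 := by rw [hK]; field_simp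
    rw [hKK, hEE]
    calc E * E * ((1 + K / 8) * y ^ 2 / N ^ 2 + 4 * y ^ 3 / N ^ 2)
        = ((1 + K / 8) * 4 * ((y / 2) ^ 2 * E) + 32 * ((y / 2) ^ 3 * E)) / N ^ 2 * E := by
          field_simp; ring
      _ ≤ ((1 + K / 8) * 4 * 2 + 32 * 6) / N ^ 2 * E := by gcongr
      _ = _ := by ring
  have hlast : Real.exp (-(y / 2)) ≤ Real.exp (-(lam ^ 2 * N ^ 2 / Real.pi ^ 2) * θ ^ 2) :=
    Real.exp_le_exp.2 (by linarith)
  refine le_trans ?_ (hmain.trans (mul_le_mul_of_nonneg_left hlast (by positivity)))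
  rw [show -(lam ^ 2 * N ^ 2 / 2) * θ ^ 2 = -w by rw [hw]; ring, abs_le]
  have n2 : 0 ≤ Real.pi ^ 4 / (8 * lam ^ 2) * y ^ 2 / N ^ 2 := by positivity
  have n1 : 0 ≤ y ^ 2 / (N : ℝ) ^ 2 := by positivity
  have n3 : 0 ≤ 4 * y ^ 3 / (N : ℝ) ^ 2 := by positivity
  have e5 : (1 + Real.pi ^ 4 / (8 * lam ^ 2)) * y ^ 2 / N ^ 2 =
      y ^ 2 / N ^ 2 + Real.pi ^ 4 / (8 * lam ^ 2) * y ^ 2 / N ^ 2 := by ring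
  rw [e5]
  clear_value w y
  generalize y ^ 2 / (N : ℝ) ^ 2 = p at *
  generalize Real.pi ^ 4 / (8 * lam ^ 2) * y ^ 2 / (N : ℝ) ^ 2 = r at *
  generalize 4 * y ^ 3 / (N : ℝ) ^ 2 = s at *
  have m1 := mul_nonneg hE.le n1
  have m2 := mul_nonneg hE.le n2
  have m3 := mul_nonneg hE.le n3
  have m4 := mul_le_mul_of_nonneg_left hwy hE.le
  constructor <;> linarith

/-- All frequencies: `H` is any bound for the amplification factor where `a ≥ 1`. -/
lemma abs_sub_gaussian_le {lam : ℝ} (hlam : 0 < lam) {N : ℕ} (hN : 2 ≤ N) {θ : ℝ} (h0 : 0 ≤ θ)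
    (hθ : θ ≤ Real.pi) {H : ℝ} (hH0 : 0 ≤ H) (hH : 1 ≤ lam ^ 2 * (1 - Real.cos θ) →
      |amplification (lam ^ 2 * (1 - Real.cos θ)) N| ≤ H) :
    |amplification (lam ^ 2 * (1 - Real.cos θ)) N - Real.exp (-(lam ^ 2 * N ^ 2 / 2) * θ ^ 2)| ≤
      (200 + Real.pi ^ 4 / lam ^ 2) / N ^ 2 * Real.exp (-(lam ^ 2 * N ^ 2 / Real.pi ^ 2) * θ ^ 2)
        + 432 / N ^ 3 + H := by
  have hN0 : (0 : ℝ) < N := by positivity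
  rcases le_total (lam ^ 2 * (1 - Real.cos θ) * N) (1 / 2) with h | h
  · have := abs_sub_gaussian_low hlam (by omega) h0 hθ h
    have h1 : (0 : ℝ) ≤ 432 / N ^ 3 := by positivity
    linarith
  · have hc := Real.one_sub_sq_div_two_le_cos (x := θ)
    have hG : Real.exp (-(lam ^ 2 * N ^ 2 / 2) * θ ^ 2) ≤ 48 / N ^ 3 := by
      have h1 : Real.exp (-(lam ^ 2 * N ^ 2 / 2) * θ ^ 2) ≤ Real.exp (-((N : ℝ) / 2)) := by
        refine Real.exp_le_exp.2 ?_
        have h2 : lam ^ 2 * (1 - Real.cos θ) * N * N ≤ lam ^ 2 * (θ ^ 2 / 2) * N * N := by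
          gcongr
          linarith
        nlinarith
      have e2 := pow_mul_exp_neg_le (x := (N : ℝ) / 2) (by positivity) 3
      norm_num [Nat.factorial] at e2
      rw [le_div_iff₀ (by positivity)]
      have e3 := mul_le_mul_of_nonneg_right h1 (by positivity : 0 ≤ (N : ℝ) ^ 3)
      nlinarith
    have hP : |amplification (lam ^ 2 * (1 - Real.cos θ)) N| ≤ 384 / N ^ 3 + H := by
      rcases le_total 1 (lam ^ 2 * (1 - Real.cos θ)) with h1 | h1
      · have : (0 : ℝ) ≤ 384 / N ^ 3 := by positivity
        linarith [hH h1]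
      · have ha : 0 < lam ^ 2 * (1 - Real.cos θ) :=
          pos_of_mul_pos_left (by linarith) hN0.le
        linarith [amplification_mid ha h1 hN h]
    have h3 : (0 : ℝ) ≤ (200 + Real.pi ^ 4 / lam ^ 2) / N ^ 2 *
        Real.exp (-(lam ^ 2 * N ^ 2 / Real.pi ^ 2) * θ ^ 2) := by positivity
    have h4 := abs_sub (amplification (lam ^ 2 * (1 - Real.cos θ)) N)
      (Real.exp (-(lam ^ 2 * N ^ 2 / 2) * θ ^ 2))
    rw [abs_of_pos (Real.exp_pos _)] at h4
    have h5 : (432 : ℝ) / N ^ 3 = 384 / N ^ 3 + 48 / N ^ 3 := by ring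
    linarith

/-- Where `a ≥ 1` the amplification factor is at most `N^{-1-2/a}`, and `2/a` exceeds its minimum
`1/λ²`, attained at `θ = π`, by a multiple of `(π - θ)²`. -/
lemma abs_amplification_le_near_pi {lam : ℝ} (hlam : 0 < lam) {N : ℕ} (hN : 1 ≤ N) {θ : ℝ}
    (h0 : 0 ≤ θ) (hθ : θ ≤ Real.pi) (h1 : 1 ≤ lam ^ 2 * (1 - Real.cos θ)) :
    |amplification (lam ^ 2 * (1 - Real.cos θ)) N| ≤ (N : ℝ) ^ (-(1 / lam ^ 2)) / N *
      Real.exp (-(Real.log N / (lam ^ 2 * Real.pi ^ 2)) * (Real.pi - θ) ^ 2) := by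
  have hπ := Real.pi_pos
  have hN' : (1 : ℝ) ≤ N := by exact_mod_cast hN
  have hN0 : (0 : ℝ) < N := by linarith
  refine (amplification_high h1 hN).trans ?_
  rw [Real.rpow_def_of_pos hN0, div_mul_eq_mul_div, ← Real.exp_add]
  gcongr
  have hL := Real.log_nonneg hN'
  have hq := two_div_pi_sq_mul_le (θ := Real.pi - θ) (by linarith) (by linarith)
  rw [Real.cos_pi_sub] at hq
  have hq0 : 0 < 1 - Real.cos θ := pos_of_mul_pos_right (by linarith) (sq_nonneg lam)
  have key : 1 + (Real.pi - θ) ^ 2 / Real.pi ^ 2 ≤ 2 / (1 - Real.cos θ) := by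
    rw [le_div_iff₀ hq0]
    have e : (Real.pi - θ) ^ 2 / Real.pi ^ 2 = 2 / Real.pi ^ 2 * (Real.pi - θ) ^ 2 / 2 := by ring
    rw [e]
    have hs : 0 ≤ 2 / Real.pi ^ 2 * (Real.pi - θ) ^ 2 := by positivity
    nlinarith [Real.neg_one_le_cos θ]
  have key2 := mul_le_mul_of_nonneg_left key (by positivity : 0 ≤ Real.log N / lam ^ 2)
  have e1 : Real.log N / lam ^ 2 * (2 / (1 - Real.cos θ)) =
      2 / (lam ^ 2 * (1 - Real.cos θ)) * Real.log N := by field_simp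
  have e2 : Real.log N / lam ^ 2 * (1 + (Real.pi - θ) ^ 2 / Real.pi ^ 2) =
      Real.log N * (1 / lam ^ 2) + Real.log N / (lam ^ 2 * Real.pi ^ 2) * (Real.pi - θ) ^ 2 := by
    field_simp
  linarith

/-! ### Integration over the frequencies -/

lemma integral_gaussian_zero_pi_le {b : ℝ} (hb : 0 < b) :
    ∫ θ in (0 : ℝ)..Real.pi, Real.exp (-b * θ ^ 2) ≤ Real.sqrt (Real.pi / b) / 2 := by
  rw [intervalIntegral.integral_of_le Real.pi_pos.le, ← integral_gaussian_Ioi]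
  exact MeasureTheory.setIntegral_mono_set (integrable_exp_neg_mul_sq hb).integrableOn
    (Eventually.of_forall fun θ => (Real.exp_pos _).le)
    Set.Ioc_subset_Ioi_self.eventuallyLE

lemma integral_gaussian_Ioi_pi_le {b : ℝ} (hb : 0 < b) :
    ∫ θ in Set.Ioi Real.pi, Real.exp (-b * θ ^ 2) ≤ Real.sqrt (Real.pi / (b / 2)) / b := by
  have hπ := Real.pi_pos
  have hi := integrable_exp_neg_mul_sq (half_pos hb)
  calc ∫ θ in Set.Ioi Real.pi, Real.exp (-b * θ ^ 2)
      ≤ ∫ θ in Set.Ioi Real.pi, 2 / b * Real.exp (-(b / 2) * θ ^ 2) := by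
        refine MeasureTheory.setIntegral_mono_on (integrable_exp_neg_mul_sq hb).integrableOn
          (hi.const_mul _).integrableOn measurableSet_Ioi fun θ hθ => ?_
        have hθ1 : 1 ≤ θ ^ 2 := by
          have : 3 < θ := Real.pi_gt_three.trans hθ
          nlinarith
        have e : Real.exp (-b * θ ^ 2) =
            Real.exp (-(b / 2 * θ ^ 2)) * Real.exp (-(b / 2) * θ ^ 2) := by
          rw [← Real.exp_add]; congr 1; ring
        rw [e]
        gcongr
        have h1 := pow_mul_exp_neg_le (x := b / 2 * θ ^ 2) (by positivity) 1
        simp only [pow_one, Nat.factorial_one, Nat.cast_one] at h1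
        rw [le_div_iff₀ hb]
        have h2 := Real.exp_pos (-(b / 2 * θ ^ 2))
        have h3 : 0 ≤ b * Real.exp (-(b / 2 * θ ^ 2)) := by positivity
        nlinarith
    _ ≤ ∫ θ in Set.Ioi 0, 2 / b * Real.exp (-(b / 2) * θ ^ 2) :=
        MeasureTheory.setIntegral_mono_set (hi.const_mul _).integrableOn
          (Eventually.of_forall fun θ => by positivity)
          (Set.Ioi_subset_Ioi hπ.le).eventuallyLE
    _ = _ := by
        rw [MeasureTheory.integral_const_mul, integral_gaussian_Ioi]
        ring

/-- The error at a grid point is at most the `L¹` distance between the two factors. -/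
lemma abs_error_le_integral {T lam h : ℝ} (hT : 0 < T) (hh : 0 < h) (N : ℕ) (j : ℤ)
    (hTh : T / h ^ 2 = lam ^ 2 * N ^ 2) :
    |fourierSolution lam h N j - heatSolution T (j * h)| ≤ 1 / (Real.pi * h) *
      ((∫ θ in (0 : ℝ)..Real.pi, |amplification (lam ^ 2 * (1 - Real.cos θ)) N -
          Real.exp (-(lam ^ 2 * N ^ 2 / 2) * θ ^ 2)|) +
        ∫ θ in Set.Ioi Real.pi, Real.exp (-(lam ^ 2 * N ^ 2 / 2) * θ ^ 2)) := by
  have hπ := Real.pi_pos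
  have hb : 0 < lam ^ 2 * N ^ 2 / 2 := by rw [← hTh]; positivity
  have hTh' : T / (2 * h ^ 2) = lam ^ 2 * N ^ 2 / 2 := by rw [← hTh]; field_simp
  have hG := integrable_exp_neg_mul_sq hb
  have hcG : MeasureTheory.Integrable fun θ : ℝ =>
      Real.cos (j * θ) * Real.exp (-(lam ^ 2 * N ^ 2 / 2) * θ ^ 2) := by
    refine hG.bdd_mul (c := 1) (by fun_prop) (Eventually.of_forall fun θ => ?_)
    exact Real.abs_cos_le_one _
  have hc := continuous_amplification lam N
  rw [heatSolution_eq_integral hT hh, fourierSolution, hTh', ← mul_sub, abs_mul,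
    abs_of_pos (by positivity : 0 < 1 / (Real.pi * h))]
  gcongr
  rw [← intervalIntegral.integral_interval_add_Ioi (b := Real.pi) hcG.integrableOn hcG.integrableOn,
    ← sub_sub, ← intervalIntegral.integral_sub
      (Continuous.intervalIntegrable (by fun_prop) _ _)
      (Continuous.intervalIntegrable (by fun_prop) _ _)]
  refine (abs_sub _ _).trans (add_le_add ?_ ?_)
  · refine (intervalIntegral.abs_integral_le_integral_abs hπ.le).trans ?_
    refine intervalIntegral.integral_mono_on hπ.le (Continuous.intervalIntegrable (by fun_prop) _ _)
      (Continuous.intervalIntegrable (by fun_prop) _ _) fun θ _ => ?_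
    rw [← mul_sub, abs_mul]
    exact mul_le_of_le_one_left (abs_nonneg _) (Real.abs_cos_le_one _)
  · refine (MeasureTheory.abs_integral_le_integral_abs).trans ?_
    refine MeasureTheory.setIntegral_mono_on hcG.abs.integrableOn hG.integrableOn
      measurableSet_Ioi fun θ _ => ?_
    rw [abs_mul, abs_of_pos (Real.exp_pos _)]
    exact mul_le_of_le_one_left (Real.exp_pos _).le (Real.abs_cos_le_one _)

lemma exists_abs_error_le {T lam : ℝ} (hT : 0 < T) (hlam : 0 < lam) :
    ∃ C : ℝ, 0 < C ∧ ∀ N : ℕ, 2 ≤ N → ∀ H : ℝ → ℝ, Continuous H → (∀ θ, 0 ≤ H θ) →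
      (∀ θ, 0 ≤ θ → θ ≤ Real.pi → 1 ≤ lam ^ 2 * (1 - Real.cos θ) →
        |amplification (lam ^ 2 * (1 - Real.cos θ)) N| ≤ H θ) → ∀ j : ℤ,
      |fourierSolution lam (spaceStep T lam N) N j - heatSolution T (j * spaceStep T lam N)| ≤
        C * (1 / N ^ 2 + N * ∫ θ in (0 : ℝ)..Real.pi, H θ) := by
  have hπ := Real.pi_pos
  have hsT := Real.sqrt_pos.2 hT
  set A := 200 + Real.pi ^ 4 / lam ^ 2 with hA
  have hA0 : 0 < A := by positivity
  set c₁ := Real.sqrt (Real.pi / (lam ^ 2 / Real.pi ^ 2)) / 2 with hc₁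
  set c₂ := Real.sqrt (Real.pi / (lam ^ 2 / 4)) / (lam ^ 2 / 2) with hc₂
  have hc₁0 : 0 ≤ c₁ := by positivity
  have hc₂0 : 0 ≤ c₂ := by positivity
  set D := lam / (Real.pi * Real.sqrt T) with hD
  have hD0 : 0 < D := by positivity
  refine ⟨D * (A * c₁ + 432 * Real.pi + c₂ + 1), by positivity, ?_⟩
  intro N hN H hHc hH0 hH j
  have hN0 : (0 : ℝ) < N := by positivity
  have hh : spaceStep T lam N = Real.sqrt T / (N * lam) := by
    rw [spaceStep, timeStep, div_div]
  have hh0 : 0 < spaceStep T lam N := by rw [hh]; positivity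
  have hTh : T / spaceStep T lam N ^ 2 = lam ^ 2 * N ^ 2 := by
    rw [hh, div_pow, Real.sq_sqrt hT.le]
    field_simp
  refine (abs_error_le_integral hT hh0 N j hTh).trans ?_
  have hc := continuous_amplification lam N
  have sqrt_scale : ∀ c : ℝ, Real.sqrt (Real.pi / (c * N ^ 2)) = Real.sqrt (Real.pi / c) / N :=
    fun c => by
      rw [← div_div, Real.sqrt_div' _ (by positivity), Real.sqrt_sq hN0.le]
  have i1 : (∫ θ in (0 : ℝ)..Real.pi, |amplification (lam ^ 2 * (1 - Real.cos θ)) N -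
      Real.exp (-(lam ^ 2 * N ^ 2 / 2) * θ ^ 2)|) ≤
      A / N ^ 2 * (c₁ / N) + 432 / N ^ 3 * Real.pi + ∫ θ in (0 : ℝ)..Real.pi, H θ := by
    calc _ ≤ ∫ θ in (0 : ℝ)..Real.pi, (A / N ^ 2 *
          Real.exp (-(lam ^ 2 * N ^ 2 / Real.pi ^ 2) * θ ^ 2) + 432 / N ^ 3 + H θ) := by
          refine intervalIntegral.integral_mono_on hπ.le
            (Continuous.intervalIntegrable (by fun_prop) _ _)
            (Continuous.intervalIntegrable (by fun_prop) _ _) fun θ hθ => ?_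
          exact abs_sub_gaussian_le hlam hN hθ.1 hθ.2 (hH0 θ) (hH θ hθ.1 hθ.2)
      _ = A / N ^ 2 * (∫ θ in (0 : ℝ)..Real.pi,
            Real.exp (-(lam ^ 2 * N ^ 2 / Real.pi ^ 2) * θ ^ 2)) + 432 / N ^ 3 * Real.pi +
            ∫ θ in (0 : ℝ)..Real.pi, H θ := by
          rw [intervalIntegral.integral_add (Continuous.intervalIntegrable (by fun_prop) _ _)
              (hHc.intervalIntegrable _ _),
            intervalIntegral.integral_add (Continuous.intervalIntegrable (by fun_prop) _ _)
              (Continuous.intervalIntegrable (by fun_prop) _ _),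
            intervalIntegral.integral_const_mul, intervalIntegral.integral_const]
          simp only [sub_zero, smul_eq_mul]
          ring
      _ ≤ _ := by
          gcongr
          refine (integral_gaussian_zero_pi_le (by positivity)).trans (le_of_eq ?_)
          rw [hc₁, show lam ^ 2 * (N : ℝ) ^ 2 / Real.pi ^ 2 = lam ^ 2 / Real.pi ^ 2 * N ^ 2 by ring,
            sqrt_scale]
          ring
  have i2 : (∫ θ in Set.Ioi Real.pi, Real.exp (-(lam ^ 2 * N ^ 2 / 2) * θ ^ 2)) ≤ c₂ / N ^ 3 := by
    refine (integral_gaussian_Ioi_pi_le (by positivity)).trans (le_of_eq ?_)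
    rw [hc₂, show lam ^ 2 * (N : ℝ) ^ 2 / 2 / 2 = lam ^ 2 / 4 * N ^ 2 by ring, sqrt_scale]
    field_simp
  have eD : 1 / (Real.pi * spaceStep T lam N) = D * N := by
    rw [hh, hD]
    field_simp
  have hI : 0 ≤ ∫ θ in (0 : ℝ)..Real.pi, H θ :=
    intervalIntegral.integral_nonneg hπ.le fun θ _ => hH0 θ
  set I := ∫ θ in (0 : ℝ)..Real.pi, H θ with hI'
  rw [eD]
  calc _ ≤ D * N * ((A / N ^ 2 * (c₁ / N) + 432 / N ^ 3 * Real.pi + I) + c₂ / N ^ 3) := by gcongr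
    _ = D * (A * c₁ + 432 * Real.pi + c₂) * (1 / N ^ 2) + D * 1 * (N * I) := by
        field_simp
        ring
    _ ≤ D * (A * c₁ + 432 * Real.pi + c₂ + 1) * (1 / N ^ 2) +
          D * (A * c₁ + 432 * Real.pi + c₂ + 1) * (N * I) := by
        have hS := mul_nonneg hA0.le hc₁0
        exact add_le_add
          (mul_le_mul_of_nonneg_right (mul_le_mul_of_nonneg_left (by linarith) hD0.le)
            (by positivity))
          (mul_le_mul_of_nonneg_right (mul_le_mul_of_nonneg_left (by linarith) hD0.le)
            (by positivity))
    _ = _ := by ring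

/-! ### Orders of convergence -/

lemma timeStep_pos {T : ℝ} (hT : 0 < T) {N : ℕ} (hN : 1 ≤ N) : 0 < timeStep T N :=
  div_pos (Real.sqrt_pos.2 hT) (by exact_mod_cast hN)

lemma spaceStep_pos {T lam : ℝ} (hT : 0 < T) (hlam : 0 < lam) {N : ℕ} (hN : 1 ≤ N) :
    0 < spaceStep T lam N :=
  div_pos (timeStep_pos hT hN) hlam

lemma spaceStep_eq (T lam : ℝ) (N : ℕ) : spaceStep T lam N = Real.sqrt T / lam / N := by
  rw [spaceStep, timeStep, div_right_comm]

lemma tendsto_spaceStep (T lam : ℝ) : Tendsto (spaceStep T lam) atTop (𝓝 0) := by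
  simp only [funext (spaceStep_eq T lam)]
  exact tendsto_const_div_atTop_nhds_zero_nat _

lemma isCrankNicolson_fourierSolution_steps {T lam : ℝ} (hT : 0 < T) (hlam : 0 < lam) {N : ℕ}
    (hN : 1 ≤ N) : IsCrankNicolson (timeStep T N) (spaceStep T lam N) N
      (fourierSolution lam (spaceStep T lam N)) :=
  isCrankNicolson_fourierSolution (timeStep_pos hT hN) (spaceStep_pos hT hlam hN)
    (by rw [spaceStep, mul_div_cancel₀ _ hlam.ne']) N

/-- By uniqueness it suffices to bound the error of the Fourier solution. -/
lemma errorIsBigO_of_forall {T lam : ℝ} (hT : 0 < T) (hlam : 0 < lam) {rate : ℝ → ℝ} {C : ℝ}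
    (hC : 0 < C) (h : ∀ᶠ N : ℕ in atTop, ∀ j : ℤ,
      |fourierSolution lam (spaceStep T lam N) N j - heatSolution T (j * spaceStep T lam N)| ≤
        C * rate (spaceStep T lam N)) : ErrorIsBigO T lam rate := by
  refine ⟨C, hC, ?_⟩
  filter_upwards [h, eventually_ge_atTop 1] with N hj hN U hU
  rw [(isCrankNicolson_fourierSolution_steps hT hlam hN).unique (timeStep_pos hT hN) hU N le_rfl]
  refine iSup_le fun j => ENNReal.ofReal_le_ofReal ?_
  rw [timeChangedSolution, Real.sq_sqrt hT.le]
  exact hj j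

lemma ErrorIsBigO.mono {T lam : ℝ} {r₁ r₂ : ℝ → ℝ} (h : ErrorIsBigO T lam r₁)
    (hr : ∀ᶠ N : ℕ in atTop, r₁ (spaceStep T lam N) ≤ r₂ (spaceStep T lam N)) :
    ErrorIsBigO T lam r₂ := by
  obtain ⟨C, hC, h⟩ := h
  refine ⟨C, hC, ?_⟩
  filter_upwards [h, hr] with N hN hrN U hU
  exact (hN U hU).trans (ENNReal.ofReal_le_ofReal (mul_le_mul_of_nonneg_left hrN hC.le))

lemma ErrorIsBigO.tendsto {T lam : ℝ} {rate : ℝ → ℝ} (h : ErrorIsBigO T lam rate)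
    (hr : Tendsto rate (𝓝 0) (𝓝 0)) (U : ℕ → ℕ → ℤ → ℝ)
    (hU : ∀ N : ℕ, 1 ≤ N → IsCrankNicolson (timeStep T N) (spaceStep T lam N) N (U N)) :
    Tendsto (fun N : ℕ => maxError T (spaceStep T lam N) (U N N)) atTop (𝓝 0) := by
  obtain ⟨C, -, h⟩ := h
  have h1 : Tendsto (fun N : ℕ => ENNReal.ofReal (C * rate (spaceStep T lam N))) atTop (𝓝 0) := by
    have := ENNReal.tendsto_ofReal ((hr.comp (tendsto_spaceStep T lam)).const_mul C)
    simpa using this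
  refine tendsto_of_tendsto_of_tendsto_of_le_of_le' tendsto_const_nhds h1
    (Eventually.of_forall fun _ => zero_le) ?_
  filter_upwards [h, eventually_ge_atTop 1] with N hN hN1
  exact hN (U N) (hU N hN1)

/-- For `λ² ≤ 1/2` no frequency has `a > 1`, and the error is `O(N⁻²)`. -/
lemma errorIsBigO_sq {T lam : ℝ} (hT : 0 < T) (hlam : 0 < lam) (h2 : lam ^ 2 ≤ 1 / 2) :
    ErrorIsBigO T lam (fun h => h ^ 2) := by
  obtain ⟨C, hC, hN⟩ := exists_abs_error_le hT hlam
  have hsT := Real.sqrt_pos.2 hT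
  refine errorIsBigO_of_forall hT hlam (C := C * (lam / Real.sqrt T) ^ 2) (by positivity) ?_
  filter_upwards [eventually_ge_atTop 2] with N hN2 j
  have hN0 : (0 : ℝ) < N := by positivity
  -- `a = 1` can occur, at `θ = π` with `λ² = 1/2`; there the factor `m = 1` vanishes.
  have hvan : ∀ θ : ℝ, 1 ≤ lam ^ 2 * (1 - Real.cos θ) →
      |amplification (lam ^ 2 * (1 - Real.cos θ)) N| ≤ 0 := fun θ h1 => by
    have h3 : lam ^ 2 * (1 - Real.cos θ) ≤ 1 := by
      nlinarith [Real.neg_one_le_cos θ, Real.cos_le_one θ]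
    rw [le_antisymm h3 h1, abs_nonpos_iff, amplification]
    exact Finset.prod_eq_zero (i := 1) (Finset.mem_range.2 (by omega)) (by norm_num)
  refine (hN N hN2 (fun _ => 0) continuous_const (fun _ => le_rfl)
    (fun θ _ _ => hvan θ) j).trans (le_of_eq ?_)
  rw [spaceStep_eq, intervalIntegral.integral_zero]
  field_simp
  ring

/-- For `λ² > 1/2` the frequencies near `π` dominate: they contribute `N^{-1/λ²} / √(log N)`. -/
lemma errorIsBigO_rpow_div_sqrt_log {T lam : ℝ} (hT : 0 < T) (hlam : 0 < lam)
    (h2 : 1 / 2 < lam ^ 2) :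
    ErrorIsBigO T lam (fun h => h ^ (1 / lam ^ 2) / Real.sqrt (Real.log (1 / h))) := by
  obtain ⟨C, hC, hN⟩ := exists_abs_error_le hT hlam
  have hπ := Real.pi_pos
  have hsT := Real.sqrt_pos.2 hT
  set s := 1 / lam ^ 2 with hs
  have hs0 : 0 < s := by positivity
  have hs2 : s < 2 := by rw [hs, div_lt_iff₀ (by positivity)]; linarith
  set c₀ := Real.sqrt T / lam with hc₀
  have hc₀0 : 0 < c₀ := by positivity
  set A := 1 / (2 - s) + Real.sqrt (Real.pi * (lam ^ 2 * Real.pi ^ 2)) / 2 with hA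
  have hA0 : 0 < A := by
    have : 0 < 2 - s := by linarith
    positivity
  refine errorIsBigO_of_forall hT hlam (C := C * A * (Real.sqrt 2 / c₀ ^ s)) (by positivity) ?_
  have hlogN : Tendsto (fun N : ℕ => Real.log N) atTop atTop :=
    Real.tendsto_log_atTop.comp tendsto_natCast_atTop_atTop
  filter_upwards [eventually_ge_atTop 2, hlogN.eventually_ge_atTop (-Real.log c₀),
    hlogN.eventually_gt_atTop (Real.log c₀), hlogN.eventually_ge_atTop 1] with N hN2 hl1 hl2 hl3 j
  have hN0 : (0 : ℝ) < N := by positivity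
  have hN1 : (1 : ℝ) ≤ N := by exact_mod_cast (by omega : 1 ≤ N)
  have hl0 : 0 < Real.log N := by linarith
  have hsl := Real.sqrt_pos.2 hl0
  have hNs : 0 < (N : ℝ) ^ (-s) := by positivity
  have hb0 : 0 < Real.log N / (lam ^ 2 * Real.pi ^ 2) := by positivity
  refine (hN N hN2 (fun θ => (N : ℝ) ^ (-s) / N *
    Real.exp (-(Real.log N / (lam ^ 2 * Real.pi ^ 2)) * (Real.pi - θ) ^ 2)) (by fun_prop)
    (fun θ => by positivity)
    (fun θ h0 hθ h1 => abs_amplification_le_near_pi hlam (by omega) h0 hθ h1) j).trans ?_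
  have hI : (N : ℝ) * ∫ θ in (0 : ℝ)..Real.pi, (N : ℝ) ^ (-s) / N *
      Real.exp (-(Real.log N / (lam ^ 2 * Real.pi ^ 2)) * (Real.pi - θ) ^ 2) ≤
      Real.sqrt (Real.pi * (lam ^ 2 * Real.pi ^ 2)) / 2 * (N ^ (-s) / Real.sqrt (Real.log N)) := by
    rw [intervalIntegral.integral_const_mul, intervalIntegral.integral_comp_sub_left
      (fun φ => Real.exp (-(Real.log N / (lam ^ 2 * Real.pi ^ 2)) * φ ^ 2)), sub_self, sub_zero]
    calc _ ≤ (N : ℝ) * ((N : ℝ) ^ (-s) / N *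
          (Real.sqrt (Real.pi / (Real.log N / (lam ^ 2 * Real.pi ^ 2))) / 2)) := by
          gcongr
          exact integral_gaussian_zero_pi_le hb0
      _ = _ := by
          rw [div_div_eq_mul_div, Real.sqrt_div (by positivity)]
          field_simp
  have hlow : 1 / (N : ℝ) ^ 2 ≤ 1 / (2 - s) * (N ^ (-s) / Real.sqrt (Real.log N)) := by
    have h1 : Real.sqrt (Real.log N) ≤ Real.log N := by
      rw [Real.sqrt_le_left (by linarith)]
      nlinarith
    have h2s : 0 < 2 - s := by linarith
    have h3 := Real.log_le_rpow_div hN0.le h2s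
    have e : (N : ℝ) ^ (2 - s) = N ^ 2 * N ^ (-s) := by
      rw [sub_eq_add_neg, Real.rpow_add hN0]
      norm_num
    rw [e] at h3
    rw [div_mul_div_comm, one_mul, div_le_div_iff₀ (by positivity) (by positivity)]
    rw [le_div_iff₀ h2s] at h3
    nlinarith
  have hh : spaceStep T lam N = c₀ / N := spaceStep_eq T lam N
  have hlogh : Real.log (1 / spaceStep T lam N) = Real.log N - Real.log c₀ := by
    rw [hh, one_div_div, Real.log_div hN0.ne' hc₀0.ne']
  have hlh0 : 0 < Real.log (1 / spaceStep T lam N) := by rw [hlogh]; linarith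
  have hconv : (N : ℝ) ^ (-s) / Real.sqrt (Real.log N) ≤ Real.sqrt 2 / c₀ ^ s *
      (spaceStep T lam N ^ s / Real.sqrt (Real.log (1 / spaceStep T lam N))) := by
    have h1 : Real.sqrt (Real.log (1 / spaceStep T lam N)) ≤
        Real.sqrt 2 * Real.sqrt (Real.log N) := by
      rw [← Real.sqrt_mul (by norm_num)]
      exact Real.sqrt_le_sqrt (by rw [hlogh]; linarith)
    have h2 : spaceStep T lam N ^ s = c₀ ^ s * N ^ (-s) := by
      rw [hh, Real.div_rpow hc₀0.le hN0.le, Real.rpow_neg hN0.le]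
      rfl
    have h3 := Real.sqrt_pos.2 hlh0
    have h4 : 0 < c₀ ^ s := by positivity
    rw [h2, div_mul_div_comm, div_le_div_iff₀ hsl (by positivity)]
    calc _ ≤ (N : ℝ) ^ (-s) * (c₀ ^ s * (Real.sqrt 2 * Real.sqrt (Real.log N))) := by gcongr
      _ = _ := by ring
  calc _ ≤ C * (1 / (2 - s) * (N ^ (-s) / Real.sqrt (Real.log N)) +
        Real.sqrt (Real.pi * (lam ^ 2 * Real.pi ^ 2)) / 2 *
          (N ^ (-s) / Real.sqrt (Real.log N))) := by gcongr
    _ = C * A * (N ^ (-s) / Real.sqrt (Real.log N)) := by rw [hA]; ring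
    _ ≤ C * A * (Real.sqrt 2 / c₀ ^ s *
        (spaceStep T lam N ^ s / Real.sqrt (Real.log (1 / spaceStep T lam N)))) := by gcongr
    _ = _ := by ring

lemma errorIsBigO_rpow {T lam : ℝ} (hT : 0 < T) (hlam : 0 < lam) (h2 : 1 / 2 ≤ lam ^ 2) :
    ErrorIsBigO T lam (fun h => h ^ (1 / lam ^ 2)) := by
  rcases h2.eq_or_lt with h | h
  · refine (errorIsBigO_sq hT hlam h.ge).mono (Eventually.of_forall fun N => le_of_eq ?_)
    rw [← h, one_div_one_div, ← Real.rpow_natCast]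
    norm_num
  · refine (errorIsBigO_rpow_div_sqrt_log hT hlam h).mono ?_
    filter_upwards [(tendsto_spaceStep T lam).eventually_le_const (Real.exp_pos (-1)),
      eventually_ge_atTop 1] with N hh hN
    have hpos := spaceStep_pos hT hlam hN
    have h1 : 1 ≤ Real.log (1 / spaceStep T lam N) := by
      rw [one_div, Real.log_inv]
      have := (Real.log_le_iff_le_exp hpos).2 hh
      linarith
    exact div_le_self (by positivity) (Real.one_le_sqrt.2 h1)

lemma sq_one_div_sqrt_two : (1 / Real.sqrt 2) ^ 2 = 1 / 2 := by
  rw [div_pow, Real.sq_sqrt (by norm_num), one_pow]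

end TimeChangedCN

theorem theorem1 (T lam : ℝ) (hT : 0 < T) (hlam : 0 < lam) :
    -- the exact solution solves the heat equation and the time-changed heat equation
    TimeChangedCN.SolvesWithDiracData (fun _ => 1 / 2) TimeChangedCN.heatSolution ∧
    TimeChangedCN.SolvesWithDiracData (fun τ => τ) TimeChangedCN.timeChangedSolution ∧
    -- the scheme has a numerical solution, and only one
    (∀ N : ℕ, 1 ≤ N →
      ∃ U : ℕ → ℤ → ℝ,
        TimeChangedCN.IsCrankNicolson (TimeChangedCN.timeStep T N)
          (TimeChangedCN.spaceStep T lam N) N U ∧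
        ∀ V : ℕ → ℤ → ℝ,
          TimeChangedCN.IsCrankNicolson (TimeChangedCN.timeStep T N)
            (TimeChangedCN.spaceStep T lam N) N V → ∀ n : ℕ, n ≤ N → V n = U n) ∧
    -- it converges in the maximum norm, whatever the value of `lam`
    (∀ U : ℕ → ℕ → ℤ → ℝ,
      (∀ N : ℕ, 1 ≤ N →
        TimeChangedCN.IsCrankNicolson (TimeChangedCN.timeStep T N)
          (TimeChangedCN.spaceStep T lam N) N (U N)) →
      Filter.Tendsto
        (fun N : ℕ => TimeChangedCN.maxError T (TimeChangedCN.spaceStep T lam N) (U N N))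
        Filter.atTop (nhds 0)) ∧
    -- the order of convergence
    (lam ≤ 1 / Real.sqrt 2 → TimeChangedCN.ErrorIsBigO T lam (fun h => h ^ 2)) ∧
    (1 / Real.sqrt 2 ≤ lam → TimeChangedCN.ErrorIsBigO T lam (fun h => h ^ (1 / lam ^ 2))) ∧
    (1 / Real.sqrt 2 < lam → TimeChangedCN.ErrorIsBigO T lam
      (fun h => h ^ (1 / lam ^ 2) / Real.sqrt (Real.log (1 / h)))) := by
  open TimeChangedCN in
  refine ⟨solves_heatSolution, solves_timeChangedSolution, fun N hN =>
    ⟨_, isCrankNicolson_fourierSolution_steps hT hlam hN, fun V hV n hn =>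
      (isCrankNicolson_fourierSolution_steps hT hlam hN).unique (timeStep_pos hT hN) hV n hn⟩,
    fun U hU => ?_, fun h => ?_, fun h => ?_, fun h => ?_⟩
  · rcases le_total (lam ^ 2) (1 / 2) with h | h
    · refine (errorIsBigO_sq hT hlam h).tendsto ?_ U hU
      simpa using (continuous_pow 2).tendsto (0 : ℝ)
    · refine (errorIsBigO_rpow hT hlam h).tendsto ?_ U hU
      have hp : 0 < 1 / lam ^ 2 := by positivity
      have ht := (Real.continuousAt_rpow_const 0 (1 / lam ^ 2) (Or.inr hp.le)).tendsto
      rwa [Real.zero_rpow hp.ne'] at ht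
  · refine errorIsBigO_sq hT hlam ?_
    rw [← sq_one_div_sqrt_two]
    gcongr
  · refine errorIsBigO_rpow hT hlam ?_
    rw [← sq_one_div_sqrt_two]
    gcongr
  · refine errorIsBigO_rpow_div_sqrt_log hT hlam ?_
    rw [← sq_one_div_sqrt_two]
    gcongr
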